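/- Let $M$ be a compact smooth $n$-manifold with boundary and corners, whose boundary is a union $\partial M=\partial_0M\cup\partial_1M$ of two codimension zero smooth submanifolds which intersect in the corner set $\partial_0M\cap\partial_1M=\partial(\partial_0M)=\partial(\partial_1M)$ (all corners have codimension two). Let $M$ be equipped with a Riemannian metric which is a product metric in a neighborhood of $\partial_1M$. Let $\mathcal P=\mathcal P(M\smallsetminus\partial_1M)$ be the following topological poset. Its elements are the pairs $(S,\rho)$ where $S$ is a finite subset of $M\smallsetminus\partial M$ and $\rho$ is a function from $S\sqcup(\partial_0M\smallsetminus\partial_1M)$ to the positive real numbers, locally constant on $\partial_0M\smallsetminus\partial_1M$, such that: for each $s\in S$ the exponential map of $M\smallsetminus\partial_1M$ at $s$ is defined and regular (an injective immersion) on the closed disk of radius $\rho(s)$ in $T_sM$; the boundary-normal exponential map of $M\smallsetminus\partial_1M$ is defined and regular (an injective immersion) on the closed band of all inward normal vectors $v$ at points $z\in\partial_0M\smallsetminus\partial_1M$ with $|v|\le\rho(z)$; and the images in $M\smallsetminus\partial_1M$ of these disks and of this band are pairwise disjoint. The topology on $\mathcal P$ is that of a disjoint union over $k=|S|$, where the part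 with $|S|=k$ has the subspace topology from the quotient, by the symmetric group $\Sigma_k$, of the space of labelled configurations of $k$ distinct points together with their $k$ real numbers and the function $\rho$ on $\partial_0M\smallsetminus\partial_1M$ (with the topology of pointwise convergence). Let $V(S,\rho)$ be the union of the open balls of radius $\rho(s)$ about the points $s\in S$ and of the half-open band of normal width $\rho$ on $\partial_0M\smallsetminus\partial_1M$. The order is defined by $(S,\rho)\le(T,\sigma)$ iff $V(S,\rho)\subseteq V(T,\sigma)$. Let $\Psi$ be the contravariant functor $\Psi(S,\rho)=M\smallsetminus V(S,\rho)$ on $\mathcal P$. For a topological poset $\mathcal Q$ and a contravariant functor $\Phi$ from $\mathcal Q$ to subspaces of $M$, the homotopy limit is $\mathrm{holim}\,\Phi=\mathrm{Tot}([r]\mapsto\Gamma_r(\Phi))$, where $\Gamma_r(\Phi)$ is the space, with the compact-open topology, of continuous maps $\tau$ to $M$ from the space of strings $u(0)\ge u(1)\ge\cdots\ge u(r)$ in $\mathcal Q$ that satisfy $\tau(u)\in\Phi(u(r))$ for all $u$. Let $\mathrm{tw}(\mathcal P)$ be the twisted arrow poset of $\mathcal P$: its elements are the relations $a\le b$ in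 $\mathcal P$, topologized as a subspace of $\mathcal P\times\mathcal P$, and $(a\le b)\le(a'\le b')$ means $a\le a'\le b'\le b$. Let $F_s\colon\mathrm{tw}(\mathcal P)\to\mathcal P$, $(a\le b)\mapsto a$, be the source functor. Then the map $$\mathrm{holim}\,\Psi\longrightarrow\mathrm{holim}\,(\Psi\circ F_s)$$ given by prolongation along $F_s$ is a weak homotopy equivalence, i.e. it induces a bijection on path components and bijections on all homotopy groups for all base points. -/

import Mathlib

open Set CategoryTheory
open scoped Manifold ContDiff Topology Topology.Homotopy

universe u v

namespace Occupants

noncomputable section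

/-! ### Weak homotopy equivalences -/

section WeakEquivalence

variable {X : Type u} {Y : Type v} [TopologicalSpace X] [TopologicalSpace Y]

/-- The map induced by `f` on sets of path components. -/
def zerothHomotopyMap (f : C(X, Y)) : ZerothHomotopy X → ZerothHomotopy Y :=
  Quotient.map' f fun _ _ h => h.map f.continuous

/-- The map induced by `f` on based maps from the cube. -/
def genLoopMap (f : C(X, Y)) (k : ℕ) (x : X) (p : Ω^ (Fin k) X x) : Ω^ (Fin k) Y (f x) :=
  ⟨f.comp p.1, fun y hy => congrArg f (p.2 y hy)⟩

/-- The map induced by `f` on the `k`-th homotopy group. -/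
def homotopyGroupMap (f : C(X, Y)) (k : ℕ) (x : X) : π_ k X x → π_ k Y (f x) :=
  Quotient.map' (genLoopMap f k x) fun _ _ h => h.map fun H => H.compContinuousMap f

/-- `f` is a weak (homotopy) equivalence: it is bijective on path components, and bijective on
all homotopy groups for all choices of base point in the source. -/
def IsWeakEquivalence (f : C(X, Y)) : Prop :=
  Function.Bijective (zerothHomotopyMap f) ∧
    ∀ k : ℕ, 1 ≤ k → ∀ x : X, Function.Bijective (homotopyGroupMap f k x)

end WeakEquivalence

/-! ### Totalization of cosimplicial spaces -/

section Tot

/-- The totalization of a cosimplicial space: the space of cosimplicial maps from the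
cosimplicial space of standard simplices to `X`, topologized as a subspace of the product of the
mapping spaces `C(Δⁿ, Xⁿ)` with their compact-open topologies. -/
def Tot (X : CosimplicialObject TopCat.{u}) : Type u :=
  {f : ∀ n : SimplexCategory, C(stdSimplex ℝ (Fin (n.len + 1)), X.obj n) //
    ∀ (m n : SimplexCategory) (α : m ⟶ n) (t : stdSimplex ℝ (Fin (m.len + 1))),
      X.map α (f m t) = f n (stdSimplex.map α.toOrderHom t)}

instance (X : CosimplicialObject TopCat.{u}) : TopologicalSpace (Tot X) :=
  instTopologicalSpaceSubtype

/-- The map on totalizations induced by a map of cosimplicial spaces. -/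
def Tot.map {X Y : CosimplicialObject TopCat.{u}} (η : X ⟶ Y) : C(Tot X, Tot Y) where
  toFun f := ⟨fun n => (η.app n).hom.comp (f.1 n), fun m n α t => by
    have h := congrArg (η.app n) (f.2 m n α t)
    have h' := congrArg (fun k => k.hom (f.1 m t)) (η.naturality α)
    exact h'.symm.trans h⟩
  continuous_toFun := by
    refine continuous_induced_rng.2 (continuous_pi fun n => ?_)
    exact (ContinuousMap.continuous_postcomp (η.app n).hom).comp
      ((continuous_apply n).comp continuous_subtype_val)

end Tot

/-! ### Homotopy limits over topological posets

The objects of a topological poset `P` form a topological space, and a contravariant functor from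
`P` to the subspaces of a fixed space `M` is a monotone map `Pᵒᵈ →o Set M`. -/

section Holim

variable {P Q : Type u} [TopologicalSpace P] [Preorder P] [TopologicalSpace Q] [Preorder Q]
variable {M : Type u} [TopologicalSpace M]

/-- The space `N_r P` of order-reversing maps `u(0) ≥ u(1) ≥ ⋯ ≥ u(r)` from `{0, …, r}`
to `P`. -/
def Nerve (P : Type u) [Preorder P] (r : ℕ) : Type u :=
  {w : Fin (r + 1) → P // Antitone w}

instance (r : ℕ) : TopologicalSpace (Nerve P r) := instTopologicalSpaceSubtype

/-- Restriction of strings along a monotone map. -/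
def Nerve.pull {r s : ℕ} (α : Fin (r + 1) →o Fin (s + 1)) : C(Nerve P s, Nerve P r) where
  toFun w := ⟨w.1 ∘ α, w.2.comp_monotone α.monotone⟩
  continuous_toFun := by
    refine continuous_induced_rng.2 (continuous_pi fun i => ?_)
    exact (continuous_apply (α i)).comp continuous_subtype_val

/-- The map of nerves induced by a continuous monotone map. -/
def Nerve.push (F : Q →o P) (hF : Continuous F) (r : ℕ) : C(Nerve Q r, Nerve P r) where
  toFun w := ⟨F ∘ w.1, F.monotone.comp_antitone w.2⟩
  continuous_toFun := by
    refine continuous_induced_rng.2 (continuous_pi fun i => ?_)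
    exact hF.comp ((continuous_apply i).comp continuous_subtype_val)

/-- The space `Γ_r(Ψ)`, with the compact-open topology, of continuous sections over `N_r P` of
the fiberwise space with fiber `Ψ(u(r)) ⊆ M` over the string `u(0) ≥ ⋯ ≥ u(r)`. -/
def SectionSpace (Ψ : Pᵒᵈ →o Set M) (r : ℕ) : Type u :=
  {σ : C(Nerve P r, M) // ∀ w, σ w ∈ Ψ (OrderDual.toDual (w.1 (Fin.last r)))}

instance (Ψ : Pᵒᵈ →o Set M) (r : ℕ) : TopologicalSpace (SectionSpace Ψ r) :=
  instTopologicalSpaceSubtype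

/-- The covariant dependence of `Γ_r(Ψ)` on `[r]`. -/
def SectionSpace.push (Ψ : Pᵒᵈ →o Set M) {r s : ℕ} (α : Fin (r + 1) →o Fin (s + 1)) :
    C(SectionSpace Ψ r, SectionSpace Ψ s) where
  toFun σ := ⟨σ.1.comp (Nerve.pull α), fun w => by
    have h : w.1 (Fin.last s) ≤ w.1 (α (Fin.last r)) := w.2 (Fin.le_last _)
    exact Ψ.monotone (OrderDual.toDual_le_toDual.2 h) (σ.2 (Nerve.pull α w))⟩
  continuous_toFun := by
    refine continuous_induced_rng.2 ?_
    exact (ContinuousMap.continuous_precomp (Nerve.pull α)).comp continuous_subtype_val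

/-- The cosimplicial space `[r] ↦ Γ_r(Ψ)`. -/
def sections (Ψ : Pᵒᵈ →o Set M) : CosimplicialObject TopCat.{u} where
  obj n := TopCat.of (SectionSpace Ψ n.len)
  map α := TopCat.ofHom (SectionSpace.push Ψ α.toOrderHom)
  map_id _ := rfl
  map_comp {_ _ _} _ _ := rfl

/-- The homotopy limit of a contravariant functor on a topological poset. -/
abbrev holim (Ψ : Pᵒᵈ →o Set M) : Type u := Tot (sections Ψ)

/-- Prolongation of sections along a continuous functor `F`, in degree `r`. -/
def SectionSpace.prolong (Ψ : Pᵒᵈ →o Set M) (F : Q →o P) (hF : Continuous F) (r : ℕ) :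
    C(SectionSpace Ψ r, SectionSpace (Ψ.comp (OrderHom.dual F)) r) where
  toFun σ := ⟨σ.1.comp (Nerve.push F hF r), fun w => σ.2 (Nerve.push F hF r w)⟩
  continuous_toFun := by
    refine continuous_induced_rng.2 ?_
    exact (ContinuousMap.continuous_precomp (Nerve.push F hF r)).comp continuous_subtype_val

/-- Prolongation of sections along a continuous functor `F`. -/
def sectionsPull (Ψ : Pᵒᵈ →o Set M) (F : Q →o P) (hF : Continuous F) :
    sections Ψ ⟶ sections (Ψ.comp (OrderHom.dual F)) where
  app n := TopCat.ofHom (SectionSpace.prolong Ψ F hF n.len)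
  naturality _ _ _ := rfl

/-- The prolongation map `holim Ψ → holim (Ψ ∘ F)` of a continuous functor `F`. -/
def holimPull (Ψ : Pᵒᵈ →o Set M) (F : Q →o P) (hF : Continuous F) :
    C(holim Ψ, holim (Ψ.comp (OrderHom.dual F))) :=
  Tot.map (sectionsPull Ψ F hF)

variable (P) in
/-- The twisted arrow poset: its objects are the relations `a ≤ b` in `P`. -/
def TwistedArrow : Type u := {p : P × P // p.1 ≤ p.2}

instance : TopologicalSpace (TwistedArrow P) := instTopologicalSpaceSubtype

/-- There is a (unique) morphism from `a ≤ b` to `a' ≤ b'` iff `a ≤ a'` and `b' ≤ b`, i.e. iff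
`a ≤ b` factors as `a ≤ a' ≤ b' ≤ b`. -/
instance : Preorder (TwistedArrow P) where
  le x y := x.1.1 ≤ y.1.1 ∧ y.1.2 ≤ x.1.2
  le_refl _ := ⟨le_rfl, le_rfl⟩
  le_trans _ _ _ h h' := ⟨h.1.trans h'.1, h'.2.trans h.2⟩

variable (P) in
/-- The functor "source" `F_s` from the twisted arrow poset of `P` to `P`. -/
def source : TwistedArrow P →o P where
  toFun x := x.1.1
  monotone' _ _ h := h.1

theorem continuous_source : Continuous (source P) :=
  continuous_fst.comp continuous_subtype_val

end Holim

/-! ### Manifolds with corners whose boundary is split into two parts -/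

section Manifold

/-- The model of `n`-dimensional manifolds with corners: the quadrant `[0, ∞)ⁿ` in `ℝⁿ`. -/
abbrev corners (n : ℕ) :
    ModelWithCorners ℝ (EuclideanSpace ℝ (Fin n)) (EuclideanQuadrant n) :=
  modelWithCornersEuclideanQuadrant n

variable (n : ℕ) (M : Type u) [TopologicalSpace M] [ChartedSpace (EuclideanQuadrant n) M]

variable {M} in
/-- The depth of a point: the number of boundary faces that meet there. -/
def depth (x : M) : ℕ := {i : Fin n | extChartAt (corners n) x x i = 0}.ncard

/-- A decomposition `∂M = ∂₀M ∪ ∂₁M` into two codimension zero submanifolds that intersect in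
the corner set, which is the boundary of each of the two; all corners have codimension two.
The last two conditions say that along the corner set one of the two local faces
belongs to `∂₀M` and the other one to `∂₁M`. -/
structure BoundarySplitting where
  /-- the part `∂₀M` of the boundary -/
  bd₀ : Set M
  /-- the part `∂₁M` of the boundary -/
  bd₁ : Set M
  isClosed₀ : IsClosed bd₀
  isClosed₁ : IsClosed bd₁
  union_eq : bd₀ ∪ bd₁ = (corners n).boundary M
  depth_le : ∀ x : M, depth n x ≤ 2
  inter_eq : bd₀ ∩ bd₁ = {x | depth n x = 2}
  closure_eq₀ : closure (bd₀ \ bd₁) = bd₀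
  closure_eq₁ : closure (bd₁ \ bd₀) = bd₁

variable [IsManifold (corners n) ∞ M]

/-- Smooth Riemannian metrics on `M`. -/
abbrev Metric : Type u :=
  Bundle.ContMDiffRiemannianMetric (corners n) ∞ (EuclideanSpace ℝ (Fin n))
    (fun x : M => TangentSpace (corners n) x)

variable {n M}

/-- The Riemannian metric `g` is a product metric in a neighborhood of `A` (a codimension zero
submanifold of the boundary, such as `∂₁M`): there is a diffeomorphism `κ` from `A × [0, ε)` to an
open neighborhood `U` of `A`, extending the inclusion of `A × {0}`, which makes `g` correspond to
the product of the metric of `A` and the standard metric of the interval. The components of the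
inverse of `κ` are denoted `p` and `h`. -/
def IsProductNear (g : Metric n M) (A : Set M) : Prop :=
  ∃ (ε : ℝ) (U : Set M) (p : M → M) (h : M → ℝ) (κ : A × Ico (0 : ℝ) ε → M),
    0 < ε ∧ IsOpen U ∧ Topology.IsEmbedding κ ∧ range κ = U ∧
    (∀ (a : A) (t : Ico (0 : ℝ) ε), (t : ℝ) = 0 → κ (a, t) = a) ∧
    (∀ (a : A) (t : Ico (0 : ℝ) ε), p (κ (a, t)) = a ∧ h (κ (a, t)) = t) ∧
    ContMDiffOn (corners n) (corners n) ∞ p U ∧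
    ContMDiffOn (corners n) 𝓘(ℝ, ℝ) ∞ h U ∧
    ∀ y ∈ U, ∀ v w : TangentSpace (corners n) y,
      g.inner y v w =
        g.inner (p y) (mfderiv (corners n) (corners n) p y v)
            (mfderiv (corners n) (corners n) p y w) +
          (show ℝ from mfderiv (corners n) 𝓘(ℝ, ℝ) h y v) *
            (show ℝ from mfderiv (corners n) 𝓘(ℝ, ℝ) h y w)

/-! ### Geodesics and exponential maps -/

/-- The metric `g` in the preferred chart at `x₀`: the inner product of the vectors represented
by `v` and `w` at the point with coordinates `x`. -/
def chartMetric (g : Metric n M) (x₀ : M) (x v w : EuclideanSpace ℝ (Fin n)) : ℝ :=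
  g.inner ((extChartAt (corners n) x₀).symm x)
    (mfderivWithin 𝓘(ℝ, EuclideanSpace ℝ (Fin n)) (corners n) (extChartAt (corners n) x₀).symm
      (range (corners n)) x v)
    (mfderivWithin 𝓘(ℝ, EuclideanSpace ℝ (Fin n)) (corners n) (extChartAt (corners n) x₀).symm
      (range (corners n)) x w)

/-- `γ` is a geodesic parametrized by `[0, 1]`: a smooth solution of the geodesic equation. The
equation is stated at each time `t`, in the chart at `γ t`, in the Euler–Lagrange form
`d/dt g_c(c', w) = ½ (∂_w g)_c(c', c')` for all constant vectors `w`, where `c` is the coordinate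
expression of `γ`. Solving for `c''` turns this into `c''ᵏ + Γᵏ_{ij} c'ⁱ c'ʲ = 0`. -/
def IsGeodesic (g : Metric n M) (γ : ℝ → M) : Prop :=
  ContMDiffOn 𝓘(ℝ, ℝ) (corners n) ∞ γ (Icc 0 1) ∧
  ∀ t ∈ Icc (0 : ℝ) 1, ∀ w : EuclideanSpace ℝ (Fin n),
    let c : ℝ → EuclideanSpace ℝ (Fin n) := fun s => extChartAt (corners n) (γ t) (γ s)
    let c' : ℝ → EuclideanSpace ℝ (Fin n) := derivWithin c (Icc 0 1)
    HasDerivWithinAt (fun s => chartMetric g (γ t) (c s) (c' s) w)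
      (1 / 2 * fderivWithin ℝ (fun x => chartMetric g (γ t) x (c' t) (c' t))
        (range (corners n)) (c t) w)
      (Icc 0 1) t

/-- `y = exp_x(v)` in the Riemannian manifold `M ∖ A`, where `v` is a tangent vector at `x`: there
is a geodesic `γ : [0, 1] → M ∖ A` with `γ(0) = x`, `γ'(0) = v` and `γ(1) = y`. -/
def IsExp (g : Metric n M) (A : Set M) (x : M) (v : EuclideanSpace ℝ (Fin n)) (y : M) : Prop :=
  ∃ γ : ℝ → M, IsGeodesic g γ ∧ (∀ t ∈ Icc (0 : ℝ) 1, γ t ∉ A) ∧ γ 0 = x ∧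
    (show EuclideanSpace ℝ (Fin n) from
      mfderivWithin 𝓘(ℝ, ℝ) (corners n) γ (Icc 0 1) 0 (1 : ℝ)) = v ∧ γ 1 = y

/-- The exponential map of `M ∖ A` is defined at the tangent vector `v` at `x`. -/
def ExpDefined (g : Metric n M) (A : Set M) (x : M) (v : EuclideanSpace ℝ (Fin n)) : Prop :=
  ∃ y, IsExp g A x v y

open Classical in
/-- The exponential map of `M ∖ A` (with value `x` where it is undefined). -/
def expMap (g : Metric n M) (A : Set M) (x : M) (v : EuclideanSpace ℝ (Fin n)) : M :=
  if h : ExpDefined g A x v then h.choose else x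

/-- The closed disk of radius `r` in the tangent space at `x`. -/
def closedDisk (g : Metric n M) (x : M) (r : ℝ) : Set (EuclideanSpace ℝ (Fin n)) :=
  {v : TangentSpace (corners n) x | g.inner x v v ≤ r ^ 2}

/-- The open disk of radius `r` in the tangent space at `x`. -/
def openDisk (g : Metric n M) (x : M) (r : ℝ) : Set (EuclideanSpace ℝ (Fin n)) :=
  {v : TangentSpace (corners n) x | g.inner x v v < r ^ 2}

/-- `F` is differentiable at `x` relative to `D`, with injective differential. -/
def RegularAt (F : EuclideanSpace ℝ (Fin n) → M) (D : Set (EuclideanSpace ℝ (Fin n)))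
    (x : EuclideanSpace ℝ (Fin n)) : Prop :=
  MDifferentiableWithinAt 𝓘(ℝ, EuclideanSpace ℝ (Fin n)) (corners n) F D x ∧
    Function.Injective
      (mfderivWithin 𝓘(ℝ, EuclideanSpace ℝ (Fin n)) (corners n) F D x)

/-- The exponential map at `x` is defined and regular (an injective immersion) on the closed
disk of radius `r`. -/
def DiskRegular (g : Metric n M) (A : Set M) (x : M) (r : ℝ) : Prop :=
  (∀ v ∈ closedDisk g x r, ExpDefined g A x v) ∧
  InjOn (expMap g A x) (closedDisk g x r) ∧
  ∀ v ∈ closedDisk g x r, RegularAt (expMap g A x) (closedDisk g x r) v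

/-- `ν` is the inward unit normal vector at the boundary point `z` of depth one. In the chart at
`z` the boundary is given by the vanishing of one coordinate. -/
def IsInwardUnitNormal (g : Metric n M) (z : M) (ν : TangentSpace (corners n) z) : Prop :=
  g.inner z ν ν = 1 ∧
  ∀ i : Fin n, extChartAt (corners n) z z i = 0 →
    0 < (show EuclideanSpace ℝ (Fin n) from ν) i ∧
    ∀ w : TangentSpace (corners n) z,
      (show EuclideanSpace ℝ (Fin n) from w) i = 0 → g.inner z ν w = 0

/-- The inward unit normal vector at a boundary point of depth one. -/
def inwardNormal (g : Metric n M) (z : M) : EuclideanSpace ℝ (Fin n) :=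
  Classical.epsilon fun ν : EuclideanSpace ℝ (Fin n) => IsInwardUnitNormal g z ν

/-- The boundary-normal exponential map of `M ∖ A`: it takes `(z, t)` to the point at distance
`t` along the inward normal geodesic that starts at the boundary point `z`. -/
def normalExp (g : Metric n M) (A : Set M) (z : M) (t : ℝ) : M :=
  expMap g A z (t • inwardNormal g z)

/-- The boundary-normal exponential map of `M ∖ A`, in the coordinates on the domain given by the
chart of `M` at a boundary point `z` of depth one. The `i`-th coordinate vanishes on the boundary
near `z`; the remaining coordinates of `x` specify a boundary point, and the `i`-th
coordinate of `x` is used for the distance `t`. -/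
def normalExpInChart (g : Metric n M) (A : Set M) (z : M) (i : Fin n)
    (x : EuclideanSpace ℝ (Fin n)) : M :=
  normalExp g A ((extChartAt (corners n) z).symm (x - EuclideanSpace.single i (x i))) (x i)

/-- The boundary-normal exponential map of `M ∖ ∂₁M` is defined and regular (an injective
immersion) on the closed band of width `b`, a function on `∂₀M ∖ ∂₁M`. -/
def BandRegular (B : BoundarySplitting n M) (g : Metric n M)
    (b : (B.bd₀ \ B.bd₁ : Set M) → ℝ) : Prop :=
  (∀ z, ∀ t ∈ Icc 0 (b z), ExpDefined g B.bd₁ (z : M) (t • inwardNormal g (z : M))) ∧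
  InjOn (fun q : (B.bd₀ \ B.bd₁ : Set M) × ℝ => normalExp g B.bd₁ q.1 q.2)
    {q | q.2 ∈ Icc 0 (b q.1)} ∧
  ∀ z, ∀ t ∈ Icc 0 (b z), ∀ i : Fin n, extChartAt (corners n) (z : M) z i = 0 →
    RegularAt (normalExpInChart g B.bd₁ z i) {x | x i ∈ Icc 0 (b z)}
      (extChartAt (corners n) (z : M) z + EuclideanSpace.single i t)

/-! ### The topological poset of thickened configurations -/

/-- Pairs `(S, ρ)` where `S` is a finite subset of `X` and `ρ` is a real-valued function
on `S ⊔ W`. The part of `ρ` on `S` is recorded by its graph. -/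
structure FatConfig (X W : Type u) where
  /-- the graph of the restriction of `ρ` to `S` -/
  graph : Finset (X × ℝ)
  injOn : InjOn Prod.fst (graph : Set (X × ℝ))
  /-- the restriction of `ρ` to `W` -/
  collar : W → ℝ

/-- The pair `(S, ρ)` obtained from a configuration of `k` distinct points, labelled by
`1, …, k`, and `k` real numbers by forgetting the labels. -/
def FatConfig.ofLabelled {X W : Type u}
    (c : Σ k : ℕ, {x : Fin k → X // Function.Injective x} × (Fin k → ℝ) × (W → ℝ)) :
    FatConfig X W where
  graph := Finset.univ.map
    ⟨fun i => (c.2.1.1 i, c.2.2.1 i), fun _ _ h => c.2.1.2 (congrArg Prod.fst h)⟩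
  injOn := by
    intro a ha b hb h
    simp only [Finset.coe_map, Finset.coe_univ, image_univ,
      mem_range] at ha hb
    obtain ⟨i, rfl⟩ := ha
    obtain ⟨j, rfl⟩ := hb
    rw [c.2.1.2 h]
  collar := c.2.2.2

/-- The topology on pairs `(S, ρ)`: the disjoint union over `k` of the quotients by the
symmetric groups of the spaces of labelled configurations of `k` distinct points with real
numbers attached to them. (Functions on `W` carry the topology of pointwise convergence; on
locally constant functions it is the product topology over the components of `W`.) -/
instance (X W : Type u) [TopologicalSpace X] : TopologicalSpace (FatConfig X W) :=
  TopologicalSpace.coinduced FatConfig.ofLabelled inferInstance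

/-- The closed disk of radius `r` about `s` in `M ∖ ∂₁M`. -/
def diskImage (B : BoundarySplitting n M) (g : Metric n M) (s : M) (r : ℝ) : Set M :=
  expMap g B.bd₁ s '' closedDisk g s r

/-- The closed band in `M ∖ ∂₁M` of normal width `b`. -/
def bandImage (B : BoundarySplitting n M) (g : Metric n M)
    (b : (B.bd₀ \ B.bd₁ : Set M) → ℝ) : Set M :=
  {y | ∃ z, ∃ t ∈ Icc 0 (b z), normalExp g B.bd₁ z t = y}

/-- The conditions on a pair `(S, ρ)`, consisting of a finite subset `S` of `M ∖ ∂M` and a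
function `ρ` on `S ⊔ (∂₀M ∖ ∂₁M)`, for it to be an element of the poset `𝒫(M ∖ ∂₁M)`. -/
structure IsAdmissible (B : BoundarySplitting n M) (g : Metric n M)
    (c : FatConfig M (B.bd₀ \ B.bd₁ : Set M)) : Prop where
  interior : ∀ a ∈ c.graph, a.1 ∉ (corners n).boundary M
  rad_pos : ∀ a ∈ c.graph, 0 < a.2
  collar_pos : ∀ z, 0 < c.collar z
  collar_locallyConstant : IsLocallyConstant c.collar
  disk_regular : ∀ a ∈ c.graph, DiskRegular g B.bd₁ a.1 a.2
  band_regular : BandRegular B g c.collar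
  disk_disjoint : ∀ a ∈ c.graph, ∀ a' ∈ c.graph, a ≠ a' →
    Disjoint (diskImage B g a.1 a.2) (diskImage B g a'.1 a'.2)
  band_disjoint : ∀ a ∈ c.graph, Disjoint (diskImage B g a.1 a.2) (bandImage B g c.collar)

/-- The topological poset `𝒫(M ∖ ∂₁M)`. -/
def OccupantPoset (B : BoundarySplitting n M) (g : Metric n M) : Type u :=
  {c : FatConfig M (B.bd₀ \ B.bd₁ : Set M) // IsAdmissible B g c}

instance (B : BoundarySplitting n M) (g : Metric n M) : TopologicalSpace (OccupantPoset B g) :=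
  instTopologicalSpaceSubtype

/-- The open set `V(S, ρ)`: the union of the open balls of radius `ρ(s)` about the elements `s`
of `S` and of the half-open band on `∂₀M ∖ ∂₁M` of normal width `ρ`. -/
def OccupantPoset.V {B : BoundarySplitting n M} {g : Metric n M} (c : OccupantPoset B g) :
    Set M :=
  {y | ∃ a ∈ c.1.graph, ∃ v ∈ openDisk g a.1 a.2, expMap g B.bd₁ a.1 v = y} ∪
    {y | ∃ z, ∃ t ∈ Ico 0 (c.1.collar z), normalExp g B.bd₁ z t = y}

/-- `(S, ρ) ≤ (T, σ)` means `V(S, ρ) ⊆ V(T, σ)`. -/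
instance (B : BoundarySplitting n M) (g : Metric n M) : Preorder (OccupantPoset B g) :=
  Preorder.lift OccupantPoset.V

/-- The contravariant functor `Ψ(S, ρ) = M ∖ V(S, ρ)` on `𝒫(M ∖ ∂₁M)`. -/
def Psi (B : BoundarySplitting n M) (g : Metric n M) : (OccupantPoset B g)ᵒᵈ →o Set M where
  toFun c := (OrderDual.ofDual c).Vᶜ
  monotone' _ _ h := compl_subset_compl.2 h

end Manifold

end

end Occupants

/-!
The theorem is an instance of a fact about arbitrary topological posets `P` and contravariant
functors `Ψ` from `P` to the subspaces of a space (`isWeakEquivalence_holimPull_source`).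

A string `(a₀ ≤ b₀) ≥ ⋯ ≥ (aᵣ ≤ bᵣ)` in the twisted arrow poset of `P` is the same thing as a string
`bᵣ ≥ ⋯ ≥ b₀ ≥ a₀ ≥ ⋯ ≥ aᵣ` in `P`. Hence the cosimplicial space of
sections of `Ψ ∘ F_s` is the edgewise subdivision `[r] ↦ X([r]ᵒᵖ * [r])` of the cosimplicial space
`X` of sections of `Ψ` (`edgewiseSections`), and prolongation along `F_s` is induced by the
inclusions of `[r]` as the second half of `[r]ᵒᵖ * [r]`.

For a point `f` of `Tot X` and `s ∈ [0, 1]`, the formula `t ↦ f ((1 - s) t, s t)`, where the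
coordinates refer to `Δ²ʳ⁺¹` as the join of two copies of `Δʳ`, defines a point `spreadTot X s f`
of the totalization of the edgewise subdivision. For `s = 1` this is the prolongation map. For
`s = 1 / 2` it is a homeomorphism (`totEdgewise`), because the images of the middle copy of `Δʳ`
in `Δ²ʳ⁺¹` under the maps `Δ²ʳ⁺¹ → Δⁿ` are the simplices of a subdivision of `Δⁿ`. In detail:
these images cover `Δⁿ` (`exists_map_spread_eq`); maps prescribed on them agree on overlaps, since
any two points of simplices have a common refinement of full support (`exists_common_refinement`)
and a monotone map of vertices is determined by its effect on one point of full support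
(`eq_of_map_eq`); and finitely many of them suffice, so that the glued map is continuous
(`continuous_of_continuous_pieces`).

The prolongation map is therefore homotopic to a homeomorphism. Finally, a map that is homotopic to
a weak equivalence is one (`IsWeakEquivalence.of_homotopic`), since the two maps induced on
homotopy groups differ by the change of base point along the track of the base point.
-/

namespace Occupants

/-! ### Homotopy invariance of weak equivalences -/

section HomotopyInvariance

open scoped unitInterval

variable {N : Type*} {X : Type u} {Y : Type v} [TopologicalSpace X]
  [TopologicalSpace Y]

/-- The deformation of the cube from the identity, at `τ = 0`, to the map that expands the
concentric subcube of half the size to the whole cube, at `τ = 1`. -/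
noncomputable def stretch (τ : I) (u : I^N) : I^N := fun i =>
  projIcc 0 1 zero_le_one ((1 + (τ : ℝ)) * u i - τ / 2)

theorem continuous_stretch : Continuous fun q : I × (I^N) => stretch q.1 q.2 := by
  unfold stretch
  refine continuous_pi fun i => continuous_projIcc.comp ?_
  fun_prop

@[simp]
theorem stretch_zero (u : I^N) : stretch 0 u = u := by
  funext i
  simp [stretch, projIcc_of_mem zero_le_one (u i).2]

theorem stretch_mem_boundary (τ : I) {u : I^N} (hu : u ∈ Cube.boundary N) :
    stretch τ u ∈ Cube.boundary N := by
  obtain ⟨i, hi⟩ := hu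
  have hτ := τ.2.1
  refine ⟨i, hi.imp (fun h => ?_) fun h => ?_⟩
  · refine projIcc_of_le_left _ ?_
    simp only [h, Icc.coe_zero]
    linarith
  · refine projIcc_of_right_le _ ?_
    simp only [h, Icc.coe_one]
    linarith

theorem genLoop_homotopic_of {x : X} {p q : Ω^ N X x} (K : I × (I^N) → X) (hK : Continuous K)
    (h0 : ∀ u, K (0, u) = p u) (h1 : ∀ u, K (1, u) = q u)
    (hb : ∀ s, ∀ u ∈ Cube.boundary N, K (s, u) = x) : GenLoop.Homotopic p q :=
  ⟨{ toFun := K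
     continuous_toFun := hK
     map_zero_left := h0
     map_one_left := h1
     prop' := fun s u hu => (hb s u hu).trans (p.2 u hu).symm }⟩

variable [Fintype N]

/-- The distance of a point of the cube from the boundary of the cube, in the maximum metric. -/
def bdDist (u : I^N) : I := Finset.univ.inf fun i => min (u i) (σ (u i))

theorem continuous_bdDist : Continuous (bdDist (N := N)) :=
  Continuous.finset_inf_apply fun i _ =>
    (continuous_apply i).min (unitInterval.continuous_symm.comp (continuous_apply i))

theorem bdDist_eq_zero {u : I^N} (hu : u ∈ Cube.boundary N) : bdDist u = 0 := by
  obtain ⟨i, hi⟩ := hu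
  refine le_antisymm ((Finset.inf_le (Finset.mem_univ i)).trans ?_) unitInterval.nonneg'
  rcases hi with hi | hi <;> simp [hi]

theorem stretch_one_mem_boundary {u : I^N} (hu : (bdDist u : ℝ) ≤ 1 / 4) :
    stretch 1 u ∈ Cube.boundary N := by
  obtain ⟨i, hi⟩ : ∃ i, (min (u i) (σ (u i)) : I) ≤ (⟨1 / 4, by norm_num, by norm_num⟩ : I) := by
    have h : bdDist u ≤ (⟨1 / 4, by norm_num, by norm_num⟩ : I) := hu
    have htop : (⟨1 / 4, by norm_num, by norm_num⟩ : I) < ⊤ :=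
      show ((1 : ℝ) / 4) < 1 by norm_num
    unfold bdDist at h
    rw [Finset.inf_le_iff htop] at h
    obtain ⟨i, -, hi⟩ := h
    exact ⟨i, hi⟩
  refine ⟨i, ?_⟩
  rcases min_le_iff.1 hi with h | h
  · refine Or.inl (projIcc_of_le_left _ ?_)
    have h' : (u i : ℝ) ≤ 1 / 4 := h
    simp only [Icc.coe_one]
    linarith
  · refine Or.inr (projIcc_of_right_le _ ?_)
    have h' : 1 - (u i : ℝ) ≤ 1 / 4 := h
    simp only [Icc.coe_one]
    linarith

/-- Gluing a map on the collar of the cube to a map on the concentric subcube, with a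
parameter space `T`. -/
theorem continuous_glue {T : Type*} [TopologicalSpace T] {a b : T × (I^N) → X} (ha : Continuous a)
    (hb : Continuous b) (hab : ∀ z, (bdDist z.2 : ℝ) = 1 / 4 → a z = b z) :
    Continuous fun z : T × (I^N) => if (bdDist z.2 : ℝ) ≤ 1 / 4 then a z else b z :=
  Continuous.if_le ha hb
    (continuous_subtype_val.comp (continuous_bdDist.comp continuous_snd)) continuous_const hab

/-- Change of base point along a path `γ` from `x` to `y`: the cube is mapped by `q` on the
concentric subcube of half the size, and by `γ` in the radial direction of the collar. -/
noncomputable def changeBase {x y : X} (γ : Path x y) (q : Ω^ N X y) : Ω^ N X x :=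
  ⟨⟨fun u => if (bdDist u : ℝ) ≤ 1 / 4 then γ.extend (4 * bdDist u) else q (stretch 1 u), by
      have h := continuous_glue (T := Unit) (a := fun z : Unit × (I^N) => γ.extend (4 * bdDist z.2))
        (b := fun z => q (stretch 1 z.2))
        (γ.continuous_extend.comp (continuous_const.mul
          (continuous_subtype_val.comp (continuous_bdDist.comp continuous_snd))))
        (q.1.continuous.comp (continuous_stretch.comp (by fun_prop : Continuous
          fun z : Unit × (I^N) => ((1 : I), z.2))))
        (fun z hz => by
          have : q (stretch 1 z.2) = y := q.2 _ (stretch_one_mem_boundary hz.le)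
          simp [hz, this])
      exact h.comp (by fun_prop : Continuous fun u : I^N => ((), u))⟩,
    fun u hu => by simp [bdDist_eq_zero hu]⟩

theorem changeBase_apply {x y : X} (γ : Path x y) (q : Ω^ N X y) (u : I^N) :
    changeBase γ q u =
      if (bdDist u : ℝ) ≤ 1 / 4 then γ.extend (4 * bdDist u) else q (stretch 1 u) := rfl

/-- If `p` is freely homotopic to `q` and the boundary of the cube moves along `γ` during the
homotopy, then `p` is homotopic to `changeBase γ q` relative to the boundary. -/
theorem homotopic_changeBase {x y : X} {γ : Path x y} {p : Ω^ N X x} {q : Ω^ N X y}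
    (G : I × (I^N) → X) (hG : Continuous G) (h0 : ∀ u, G (0, u) = p u)
    (h1 : ∀ u, G (1, u) = q u) (hb : ∀ s, ∀ u ∈ Cube.boundary N, G (s, u) = γ s) :
    GenLoop.Homotopic p (changeBase γ q) := by
  refine genLoop_homotopic_of
    (fun z => G (projIcc 0 1 zero_le_one ((z.1 : ℝ) * (4 * bdDist z.2)), stretch z.1 z.2))
    (hG.comp ((continuous_projIcc.comp ?_).prodMk continuous_stretch)) (fun u => ?_)
    (fun u => ?_) fun s u hu => ?_
  · exact (continuous_subtype_val.comp continuous_fst).mul (continuous_const.mul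
      (continuous_subtype_val.comp (continuous_bdDist.comp continuous_snd)))
  · simpa using h0 u
  · rw [changeBase_apply]
    split_ifs with h
    · simp only [Icc.coe_one, one_mul]
      exact hb _ _ (stretch_one_mem_boundary h)
    · rw [← h1, projIcc_of_right_le]
      · rfl
      · simp only [Icc.coe_one]
        linarith
  · simp only [bdDist_eq_zero hu, Icc.coe_zero, mul_zero]
    rw [hb _ _ (stretch_mem_boundary s hu)]
    simp

theorem changeBase_congr {x y : X} (γ : Path x y) {q q' : Ω^ N X y}
    (h : GenLoop.Homotopic q q') :
    GenLoop.Homotopic (changeBase γ q) (changeBase γ q') := by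
  obtain ⟨F⟩ := h
  have hF : ∀ s, ∀ u ∈ Cube.boundary N, F (s, u) = y := fun s u hu =>
    (F.eq_fst s hu).trans (q.2 u hu)
  refine genLoop_homotopic_of
    (fun z => if (bdDist z.2 : ℝ) ≤ 1 / 4 then γ.extend (4 * bdDist z.2) else
      F (z.1, stretch 1 z.2))
    (continuous_glue ?_ ?_ fun z hz => ?_) (fun u => ?_) (fun u => ?_) fun s u hu => ?_
  · exact γ.continuous_extend.comp (continuous_const.mul
      (continuous_subtype_val.comp (continuous_bdDist.comp continuous_snd)))
  · exact F.continuous.comp (continuous_fst.prodMk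
      (continuous_stretch.comp (continuous_const.prodMk continuous_snd)))
  · rw [hF _ _ (stretch_one_mem_boundary hz.le)]
    simp [hz]
  · rw [changeBase_apply]
    simp only [F.apply_zero]
    rfl
  · rw [changeBase_apply]
    simp only [F.apply_one]
    rfl
  · simp [bdDist_eq_zero hu]

theorem changeBase_symm_changeBase {x y : X} (γ : Path x y) (q : Ω^ N X y) :
    GenLoop.Homotopic q (changeBase γ.symm (changeBase γ q)) := by
  let q' : Ω^ N X y := ⟨⟨fun u => q (stretch 1 u), q.1.continuous.comp
    (continuous_stretch.comp (continuous_const.prodMk continuous_id))⟩,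
    fun u hu => q.2 _ (stretch_mem_boundary 1 hu)⟩
  have h₁ : GenLoop.Homotopic q q' := by
    refine genLoop_homotopic_of (fun z => q (stretch z.1 z.2))
      (q.1.continuous.comp continuous_stretch) (fun u => by simp) (fun u => rfl)
      fun s u hu => q.2 _ (stretch_mem_boundary s hu)
  refine h₁.trans ?_
  -- At time `s`, the collar runs through the part of `γ` between the parameters `1 - s` and `1`.
  refine homotopic_changeBase
    (fun z => if (bdDist z.2 : ℝ) ≤ 1 / 4 then γ.extend (1 - z.1 + z.1 * (4 * bdDist z.2)) else
      q (stretch 1 z.2))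
    (continuous_glue ?_ ?_ fun z hz => ?_) (fun u => ?_) (fun u => ?_) fun s u hu => ?_
  · have h1 : Continuous fun z : I × (I^N) => (z.1 : ℝ) :=
      continuous_subtype_val.comp continuous_fst
    exact γ.continuous_extend.comp ((continuous_const.sub h1).add (h1.mul (continuous_const.mul
      (continuous_subtype_val.comp (continuous_bdDist.comp continuous_snd)))))
  · exact q.1.continuous.comp
      (continuous_stretch.comp (continuous_const.prodMk continuous_snd))
  · have : q (stretch 1 z.2) = y := q.2 _ (stretch_one_mem_boundary hz.le)
    simp [hz, this]
  · change _ = q (stretch 1 u)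
    split_ifs with h
    · have : q (stretch 1 u) = y := q.2 _ (stretch_one_mem_boundary h)
      simp [this]
    · rfl
  · simp [changeBase_apply]
  · simp only [bdDist_eq_zero hu]
    simp only [Icc.coe_zero, mul_zero, add_zero]
    rw [if_pos (by norm_num)]
    exact γ.extend_apply (σ s).2

/-- Change of base point on homotopy groups. -/
noncomputable def changeBaseMap {k : ℕ} {x y : X} (γ : Path x y) : π_ k X y → π_ k X x :=
  Quotient.map' (changeBase γ) fun _ _ h => changeBase_congr γ h

theorem changeBaseMap_bijective {k : ℕ} {x y : X} (γ : Path x y) :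
    Function.Bijective (changeBaseMap (k := k) γ) := by
  have key : ∀ {x y : X} (γ : Path x y), Function.LeftInverse (changeBaseMap (k := k) γ.symm)
      (changeBaseMap (k := k) γ) := by
    rintro x y γ ⟨q⟩
    exact Quotient.sound' (changeBase_symm_changeBase γ q).symm
  refine ⟨(key γ).injective, fun a => ⟨changeBaseMap γ.symm a, ?_⟩⟩
  simpa using key γ.symm a

theorem homotopyGroupMap_eq_changeBaseMap {f h : C(X, Y)} (H : f.Homotopy h) (k : ℕ) (x : X) :
    homotopyGroupMap f k x = changeBaseMap (H.evalAt x) ∘ homotopyGroupMap h k x := by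
  funext a
  obtain ⟨p⟩ := a
  refine Quotient.sound' (homotopic_changeBase (fun z => H (z.1, p z.2)) ?_ (fun u => ?_)
    (fun u => ?_) fun s u hu => ?_)
  · exact H.continuous.comp (continuous_fst.prodMk (p.1.continuous.comp continuous_snd))
  · exact H.apply_zero _
  · exact H.apply_one _
  · have : p u = x := p.2 u hu
    simp [this]

theorem zerothHomotopyMap_eq {f h : C(X, Y)} (H : f.Homotopy h) :
    zerothHomotopyMap f = zerothHomotopyMap h := by
  funext a
  obtain ⟨x⟩ := a
  exact Quotient.sound' ⟨H.evalAt x⟩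

theorem IsWeakEquivalence.of_homotopic {f h : C(X, Y)} (H : f.Homotopic h)
    (hh : IsWeakEquivalence h) : IsWeakEquivalence f := by
  obtain ⟨H⟩ := H
  refine ⟨zerothHomotopyMap_eq H ▸ hh.1, fun k hk x => ?_⟩
  rw [homotopyGroupMap_eq_changeBaseMap H]
  exact (changeBaseMap_bijective _).comp (hh.2 k hk x)

theorem isWeakEquivalence_homeomorph (e : X ≃ₜ Y) :
    IsWeakEquivalence (e : C(X, Y)) := by
  refine ⟨⟨?_, ?_⟩, fun k _ x => ⟨?_, ?_⟩⟩
  · rintro ⟨a⟩ ⟨b⟩ hab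
    obtain ⟨γ⟩ := Quotient.exact' hab
    exact Quotient.sound' ⟨(γ.map e.symm.continuous).cast (by simp) (by simp)⟩
  · rintro ⟨b⟩
    exact ⟨Quotient.mk'' (e.symm b), congrArg (Quotient.mk'' (s₁ := pathSetoid Y))
      (e.apply_symm_apply b)⟩
  · rintro ⟨p⟩ ⟨q⟩ hpq
    obtain ⟨F⟩ := Quotient.exact' hpq
    refine Quotient.sound' (genLoop_homotopic_of (fun z => e.symm (F z))
      (e.symm.continuous.comp F.continuous) (fun u => ?_) (fun u => ?_) fun s u hu => ?_)
    · exact (congrArg e.symm (F.apply_zero u)).trans (e.symm_apply_apply _)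
    · exact (congrArg e.symm (F.apply_one u)).trans (e.symm_apply_apply _)
    · have h : F (s, u) = e x := (F.eq_fst s hu).trans (congrArg e (p.2 u hu))
      simp [h]
  · rintro ⟨q⟩
    refine ⟨Quotient.mk'' ⟨⟨fun u => e.symm (q u), e.symm.continuous.comp q.1.continuous⟩,
      fun u hu => ?_⟩, ?_⟩
    · have h : q u = e x := q.2 u hu
      simp [h]
    · refine congrArg Quotient.mk'' (GenLoop.ext _ _ fun u => ?_)
      exact e.apply_symm_apply _

end HomotopyInvariance

/-! ### Simplices as spaces of probability measures on finite ordinals -/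

section Mass

variable {ι κ : Type*} [Fintype ι] [Fintype κ]

/-- The measure of `A` with respect to the probability measure on `ι` with weights `t`. -/
noncomputable def mass (t : stdSimplex ℝ ι) (A : Set ι) : ℝ := ∑ i, A.indicator t i

theorem mass_map (f : ι → κ) (t : stdSimplex ℝ ι) (A : Set κ) :
    mass (stdSimplex.map f t) A = mass t (f ⁻¹' A) := by
  classical
  unfold mass
  rw [← Finset.sum_fiberwise Finset.univ f]
  refine Finset.sum_congr rfl fun k _ => ?_
  by_cases hk : k ∈ A
  · rw [indicator_of_mem hk, stdSimplex.map_coe, FunOnFinite.linearMap_apply_apply]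
    refine Finset.sum_congr rfl fun i hi => ?_
    rw [indicator_of_mem]
    simpa [(Finset.mem_filter.1 hi).2] using hk
  · rw [indicator_of_notMem hk]
    refine (Finset.sum_eq_zero fun i hi => ?_).symm
    rw [indicator_of_notMem]
    simpa [(Finset.mem_filter.1 hi).2] using hk

theorem mass_nonneg (t : stdSimplex ℝ ι) (A : Set ι) : 0 ≤ mass t A :=
  Finset.sum_nonneg fun i _ => indicator_nonneg (fun j _ => stdSimplex.zero_le t j) i

theorem mass_mono (t : stdSimplex ℝ ι) {A B : Set ι} (h : A ⊆ B) : mass t A ≤ mass t B :=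
  Finset.sum_le_sum fun i _ =>
    indicator_le_indicator_of_subset h (fun j => stdSimplex.zero_le t j) i

@[simp]
theorem mass_univ (t : stdSimplex ℝ ι) : mass t univ = 1 := by
  simp [mass]

@[simp]
theorem mass_empty (t : stdSimplex ℝ ι) : mass t ∅ = 0 := by
  simp [mass]

theorem mass_le_one (t : stdSimplex ℝ ι) (A : Set ι) : mass t A ≤ 1 :=
  mass_univ t ▸ mass_mono t (subset_univ A)

theorem mass_compl (t : stdSimplex ℝ ι) (A : Set ι) : mass t Aᶜ = 1 - mass t A := by
  rw [eq_sub_iff_add_eq, ← mass_univ t]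
  unfold mass
  rw [← Finset.sum_add_distrib]
  refine Finset.sum_congr rfl fun i _ => ?_
  by_cases h : i ∈ A <;> simp [h]

theorem mass_insert (t : stdSimplex ℝ ι) {A : Set ι} {a : ι} (ha : a ∉ A) :
    mass t (insert a A) = t a + mass t A := by
  classical
  unfold mass
  rw [← Finset.add_sum_erase _ _ (Finset.mem_univ a),
    ← Finset.add_sum_erase (a := a) _ (A.indicator t) (Finset.mem_univ a),
    indicator_of_notMem ha, zero_add, indicator_of_mem (mem_insert a A)]
  congr 1
  refine Finset.sum_congr rfl fun i hi => ?_
  have hi' := Finset.ne_of_mem_erase hi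
  by_cases h : i ∈ A <;> simp [h, hi']

/-- For a measure of full support, nested sets of the same measure are equal. -/
theorem eq_of_subset_of_mass_eq {t : stdSimplex ℝ ι} (ht : ∀ i, 0 < t i) {A B : Set ι}
    (h : A ⊆ B) (hAB : mass t A = mass t B) : A = B := by
  refine h.antisymm fun b hb => by_contra fun hbA => ?_
  have h₁ := mass_mono t (insert_subset hb h)
  rw [mass_insert t hbA, hAB] at h₁
  linarith [ht b]

theorem mass_Iic_zero {n : ℕ} (t : stdSimplex ℝ (Fin (n + 1))) : mass t (Iic 0) = t 0 := by
  have : (Iic (0 : Fin (n + 1))) = insert 0 ∅ := by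
    ext i
    simp
  rw [this, mass_insert t (by simp), mass_empty, add_zero]

theorem mass_Iic_succ {n : ℕ} (t : stdSimplex ℝ (Fin (n + 1))) (i : Fin n) :
    mass t (Iic i.succ) = t i.succ + mass t (Iic i.castSucc) := by
  have : Iic i.succ = insert i.succ (Iic i.castSucc) := by
    ext j
    simp only [mem_Iic, mem_insert_iff, Fin.le_def, Fin.ext_iff, Fin.val_succ, Fin.val_castSucc]
    omega
  rw [this, mass_insert]
  simp [Fin.le_def]

@[simp]
theorem mass_Iic_last {n : ℕ} (t : stdSimplex ℝ (Fin (n + 1))) : mass t (Iic (Fin.last n)) = 1 := by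
  rw [← mass_univ t]
  congr 1
  ext i
  simp [Fin.le_last]

/-- A probability measure on a finite ordinal is determined by its distribution function. -/
theorem stdSimplex_ext_mass {n : ℕ} {s t : stdSimplex ℝ (Fin (n + 1))}
    (h : ∀ k, mass s (Iic k) = mass t (Iic k)) : s = t := by
  refine stdSimplex.ext (funext fun k => ?_)
  refine Fin.cases ?_ (fun i => ?_) k
  · simpa only [mass_Iic_zero] using h 0
  · have h₁ := h i.succ
    rw [mass_Iic_succ, mass_Iic_succ, h] at h₁
    exact add_right_cancel h₁

/-- Every distribution function is that of a probability measure. -/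
theorem exists_stdSimplex_mass_eq {n : ℕ} (c : Fin (n + 1) → ℝ) (hc : Monotone c) (h0 : 0 ≤ c 0)
    (h1 : c (Fin.last n) = 1) : ∃ t : stdSimplex ℝ (Fin (n + 1)), ∀ i, mass t (Iic i) = c i := by
  let w : Fin (n + 1) → ℝ := Fin.cases (c 0) fun i => c i.succ - c i.castSucc
  have hw : ∑ i, w i = c (Fin.last n) := by
    rw [Fin.sum_univ_succ]
    change c 0 + ∑ i : Fin n, (c i.succ - c i.castSucc) = _
    have h₁ := Fin.sum_univ_succ c
    have h₂ := Fin.sum_univ_castSucc c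
    rw [Finset.sum_sub_distrib]
    linarith
  let t : stdSimplex ℝ (Fin (n + 1)) := ⟨w, fun k => by
    refine Fin.cases h0 (fun i => ?_) k
    exact sub_nonneg.2 (hc (Fin.castSucc_le_succ i)), hw.trans h1⟩
  refine ⟨t, fun i => ?_⟩
  induction i using Fin.induction with
  | zero => exact mass_Iic_zero t
  | succ i ih =>
    rw [mass_Iic_succ, ih]
    exact sub_add_cancel _ _

end Mass

section Coupling

/-- The monotone rearrangement: a measure `t` on `{0, …, n}` is the image of a measure `w` on
`{0, …, N}` under a monotone map as soon as the values of the distribution function of `t` are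
`w`-measures of initial segments. -/
theorem exists_map_eq {N n : ℕ} (w : stdSimplex ℝ (Fin (N + 1))) (t : stdSimplex ℝ (Fin (n + 1)))
    (h : ∀ k, ∃ A : Set (Fin (N + 1)), IsLowerSet A ∧ mass w A = mass t (Iic k)) :
    ∃ α : Fin (N + 1) →o Fin (n + 1), stdSimplex.map α w = t := by
  classical
  have hex : ∀ i, ∃ k, mass w (Iic i) ≤ mass t (Iic k) := fun i =>
    ⟨Fin.last n, by simpa using mass_le_one w _⟩
  -- `a i` is the least `k` such that `t (Iic k)` is at least `w (Iic i)`.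
  let a : Fin (N + 1) → Fin (n + 1) := fun i => Fin.find _ (hex i)
  have ha : ∀ i k, a i ≤ k ↔ mass w (Iic i) ≤ mass t (Iic k) := by
    intro i k
    refine ⟨fun hk => ?_, fun hk => Fin.find_le_of_pos (hex i) hk⟩
    exact (Fin.find_spec (hex i)).trans (mass_mono t (Iic_subset_Iic.2 hk))
  refine ⟨⟨a, fun i j hij => ?_⟩, stdSimplex_ext_mass fun k => ?_⟩
  · rw [ha]
    exact (mass_mono w (Iic_subset_Iic.2 hij)).trans ((ha j _).1 le_rfl)
  · rw [mass_map]
    obtain ⟨A, hA, hAk⟩ := h k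
    refine le_antisymm ?_ ?_
    · rcases eq_empty_or_nonempty (a ⁻¹' Iic k) with he | hne
      · have := mass_nonneg t (Iic k)
        change mass w (a ⁻¹' Iic k) ≤ _
        simpa [he] using this
      · obtain ⟨m, hm, hmax⟩ := (toFinite (a ⁻¹' Iic k)).exists_maximalFor id _ hne
        refine (mass_mono w fun i hi => ?_).trans ((ha m k).1 hm)
        exact (le_total i m).elim id fun hmi => hmax hi hmi
    · rw [← hAk]
      refine mass_mono w fun i hi => (ha i k).2 ?_
      rw [← hAk]
      exact mass_mono w fun j hj => hA hj hi

/-- A monotone map is determined by the image of any measure of full support. -/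
theorem eq_of_map_eq {N n : ℕ} {w : stdSimplex ℝ (Fin (N + 1))} (hw : ∀ i, 0 < w i)
    {α β : Fin (N + 1) →o Fin (n + 1)} (h : stdSimplex.map α w = stdSimplex.map β w) : α = β := by
  have key : ∀ k, α ⁻¹' Iic k = β ⁻¹' Iic k := by
    intro k
    have hk : mass w (α ⁻¹' Iic k) = mass w (β ⁻¹' Iic k) := by
      rw [← mass_map, h, mass_map]
    have hα : IsLowerSet (α ⁻¹' Iic k) := (isLowerSet_Iic k).preimage α.monotone
    have hβ : IsLowerSet (β ⁻¹' Iic k) := (isLowerSet_Iic k).preimage β.monotone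
    rcases hα.total hβ with hs | hs
    · exact eq_of_subset_of_mass_eq hw hs hk
    · exact (eq_of_subset_of_mass_eq hw hs hk.symm).symm
  refine OrderHom.ext _ _ (funext fun i => le_antisymm ?_ ?_)
  · exact (key (β i)).ge (le_refl (β i))
  · exact (key (α i)).le (le_refl (α i))

/-- Two points of simplices have a common refinement: they are images, under monotone maps, of
one and the same interior point of some simplex. -/
theorem exists_common_refinement {r r' : ℕ} (t : stdSimplex ℝ (Fin (r + 1)))
    (t' : stdSimplex ℝ (Fin (r' + 1))) :
    ∃ (m : ℕ) (w : stdSimplex ℝ (Fin (m + 1))) (β : Fin (m + 1) →o Fin (r + 1))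
      (β' : Fin (m + 1) →o Fin (r' + 1)), (∀ i, 0 < w i) ∧
      stdSimplex.map β w = t ∧ stdSimplex.map β' w = t' := by
  classical
  -- The positive values of the two distribution functions are used to subdivide `[0, 1]`.
  let S : Finset ℝ := ((Finset.univ.image fun k => mass t (Iic k)) ∪
    (Finset.univ.image fun k => mass t' (Iic k))).filter (0 < ·)
  have hSle : ∀ x ∈ S, x ≤ 1 := by
    intro x hx
    simp only [S, Finset.mem_filter, Finset.mem_union, Finset.mem_image, Finset.mem_univ,
      true_and] at hx
    rcases hx.1 with ⟨k, rfl⟩ | ⟨k, rfl⟩ <;> exact mass_le_one _ _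
  have hSpos : ∀ x ∈ S, 0 < x := fun x hx => (Finset.mem_filter.1 hx).2
  have hS1 : (1 : ℝ) ∈ S := by
    refine Finset.mem_filter.2 ⟨Finset.mem_union_left _ ?_, one_pos⟩
    exact Finset.mem_image.2 ⟨Fin.last r, Finset.mem_univ _, mass_Iic_last t⟩
  obtain ⟨m, hm⟩ : ∃ m, S.card = m + 1 :=
    Nat.exists_eq_succ_of_ne_zero (Finset.card_ne_zero_of_mem hS1)
  let c := S.orderIsoOfFin hm
  have hc : StrictMono fun i => (c i : ℝ) := fun i j hij => c.strictMono hij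
  obtain ⟨w, hw⟩ := exists_stdSimplex_mass_eq (fun i => (c i : ℝ)) hc.monotone
    (hSpos _ (c 0).2).le (by
      refine le_antisymm (hSle _ (c _).2) ?_
      have := hc.monotone (Fin.le_last (c.symm ⟨1, hS1⟩))
      simpa using this)
  have hw0 : ∀ i, 0 < w i := by
    intro i
    refine Fin.cases ?_ (fun i => ?_) i
    · rw [← mass_Iic_zero, hw]
      exact hSpos _ (c 0).2
    · have h₁ := mass_Iic_succ w i
      have h₂ : (c i.castSucc : ℝ) < c i.succ := hc (Fin.castSucc_lt_succ)
      rw [hw, hw] at h₁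
      linarith
  have hlow : ∀ x : ℝ, (0 < x → x ∈ S) → 0 ≤ x →
      ∃ A : Set (Fin (m + 1)), IsLowerSet A ∧ mass w A = x := by
    intro x hx h0
    rcases h0.eq_or_lt with rfl | hpos
    · exact ⟨∅, isLowerSet_empty, mass_empty w⟩
    · exact ⟨Iic (c.symm ⟨x, hx hpos⟩), isLowerSet_Iic _, by simp [hw]⟩
  obtain ⟨β, hβ⟩ := exists_map_eq w t fun k => hlow _ (fun h => Finset.mem_filter.2
    ⟨Finset.mem_union_left _ (Finset.mem_image_of_mem _ (Finset.mem_univ k)), h⟩) (mass_nonneg _ _)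
  obtain ⟨β', hβ'⟩ := exists_map_eq w t' fun k => hlow _ (fun h => Finset.mem_filter.2
    ⟨Finset.mem_union_right _ (Finset.mem_image_of_mem _ (Finset.mem_univ k)), h⟩) (mass_nonneg _ _)
  exact ⟨m, w, β, β', hw0, hβ, hβ'⟩

end Coupling

/-! ### The edgewise subdivision of a simplex -/

section Edgewise

/-- The order-reversing inclusion of `{0, …, r}` as the first half of `{0, …, 2r + 1}`. -/
def leftHalf (r : ℕ) (i : Fin (r + 1)) : Fin (2 * r + 1 + 1) := ⟨r - i, by omega⟩

/-- The order-preserving inclusion of `{0, …, r}` as the second half of `{0, …, 2r + 1}`. -/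
def rightHalf (r : ℕ) : Fin (r + 1) →o Fin (2 * r + 1 + 1) where
  toFun i := ⟨r + 1 + i, by omega⟩
  monotone' i j h := by
    simp only [Fin.le_def] at h ⊢
    omega

theorem val_leftHalf {r : ℕ} (i : Fin (r + 1)) : (leftHalf r i : ℕ) = r - i := rfl

theorem val_rightHalf {r : ℕ} (i : Fin (r + 1)) : (rightHalf r i : ℕ) = r + 1 + i := rfl

theorem eq_leftHalf_or_rightHalf {r : ℕ} (j : Fin (2 * r + 1 + 1)) :
    (∃ i, leftHalf r i = j) ∨ ∃ i, rightHalf r i = j := by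
  rcases le_or_gt (j : ℕ) r with h | h
  · exact Or.inl ⟨⟨r - j, by omega⟩, Fin.ext (by rw [val_leftHalf]; dsimp only; omega)⟩
  · exact Or.inr ⟨⟨j - (r + 1), by omega⟩, Fin.ext (by rw [val_rightHalf]; dsimp only; omega)⟩

theorem leftHalf_le_leftHalf {r : ℕ} {i j : Fin (r + 1)} :
    leftHalf r i ≤ leftHalf r j ↔ j ≤ i := by
  rw [Fin.le_def, Fin.le_def, val_leftHalf, val_leftHalf]
  omega

theorem leftHalf_lt_leftHalf {r : ℕ} {i j : Fin (r + 1)} :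
    leftHalf r i < leftHalf r j ↔ j < i :=
  lt_iff_lt_of_le_iff_le leftHalf_le_leftHalf

theorem rightHalf_le_rightHalf {r : ℕ} {i j : Fin (r + 1)} :
    rightHalf r i ≤ rightHalf r j ↔ i ≤ j := by
  rw [Fin.le_def, Fin.le_def, val_rightHalf, val_rightHalf]
  omega

theorem leftHalf_lt_rightHalf {r : ℕ} (i j : Fin (r + 1)) : leftHalf r i < rightHalf r j := by
  rw [Fin.lt_def, val_leftHalf, val_rightHalf]
  omega

/-- A monotone map applied in each of the two halves of `{0, …, 2r + 1}`. -/
def double {m r : ℕ} (α : Fin (m + 1) →o Fin (r + 1)) :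
    Fin (2 * m + 1 + 1) →o Fin (2 * r + 1 + 1) where
  toFun j := if h : (j : ℕ) ≤ m then leftHalf r (α ⟨m - j, by omega⟩) else
    rightHalf r (α ⟨j - (m + 1), by omega⟩)
  monotone' i j hij := by
    have hij' : (i : ℕ) ≤ j := hij
    dsimp only
    split_ifs with hi hj hj
    · exact leftHalf_le_leftHalf.2 (α.monotone (by simp only [Fin.le_def]; omega))
    · exact (leftHalf_lt_rightHalf _ _).le
    · omega
    · exact rightHalf_le_rightHalf.2 (α.monotone (by simp only [Fin.le_def]; omega))

@[simp]
theorem double_leftHalf {m r : ℕ} (α : Fin (m + 1) →o Fin (r + 1)) (i : Fin (m + 1)) :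
    double α (leftHalf m i) = leftHalf r (α i) := by
  refine (dif_pos (show m - (i : ℕ) ≤ m by omega)).trans ?_
  congr 2
  exact Fin.ext (show m - (m - (i : ℕ)) = i by omega)

@[simp]
theorem double_rightHalf {m r : ℕ} (α : Fin (m + 1) →o Fin (r + 1)) (i : Fin (m + 1)) :
    double α (rightHalf m i) = rightHalf r (α i) := by
  refine (dif_neg (show ¬ m + 1 + (i : ℕ) ≤ m by omega)).trans ?_
  congr 2
  exact Fin.ext (show m + 1 + (i : ℕ) - (m + 1) = i by omega)

theorem orderHom_ext_halves {r : ℕ} {β : Type*} [Preorder β] {f g : Fin (2 * r + 1 + 1) →o β}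
    (hl : ∀ i, f (leftHalf r i) = g (leftHalf r i))
    (hr : ∀ i, f (rightHalf r i) = g (rightHalf r i)) : f = g := by
  refine OrderHom.ext _ _ (funext fun j => ?_)
  obtain ⟨i, rfl⟩ | ⟨i, rfl⟩ := eq_leftHalf_or_rightHalf j
  · exact hl i
  · exact hr i

/-- The edgewise subdivision functor, which takes the ordinal `[r]` to the join `[r]ᵒᵖ * [r]`. -/
def edgewise : SimplexCategory ⥤ SimplexCategory where
  obj n := SimplexCategory.mk (2 * n.len + 1)
  map α := SimplexCategory.Hom.mk (double α.toOrderHom)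
  map_id n := by
    refine SimplexCategory.Hom.ext _ _ (orderHom_ext_halves (fun i => ?_) fun i => ?_)
    · exact double_leftHalf _ i
    · exact double_rightHalf _ i
  map_comp α β := by
    refine SimplexCategory.Hom.ext _ _ (orderHom_ext_halves (fun i => ?_) fun i => ?_)
    · refine (double_leftHalf _ i).trans ?_
      change _ = double β.toOrderHom (double α.toOrderHom _)
      rw [double_leftHalf, double_leftHalf]
      rfl
    · refine (double_rightHalf _ i).trans ?_
      change _ = double β.toOrderHom (double α.toOrderHom _)
      rw [double_rightHalf, double_rightHalf]
      rfl

/-- The natural inclusion of `[r]` as the second half of `[r]ᵒᵖ * [r]`. -/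
def toEdgewise : 𝟭 SimplexCategory ⟶ edgewise where
  app n := SimplexCategory.Hom.mk (rightHalf n.len)
  naturality m n α := by
    refine SimplexCategory.Hom.ext _ _ (OrderHom.ext _ _ (funext fun i => ?_))
    exact (double_rightHalf α.toOrderHom i).symm

/-- The point of the simplex `Δ²ʳ⁺¹`, viewed as the join of two copies of `Δʳ`, that divides
in the ratio `s` the segment between the copies of `t` in the two halves. -/
noncomputable def spread {r : ℕ} (s : unitInterval) (t : stdSimplex ℝ (Fin (r + 1))) :
    stdSimplex ℝ (Fin (2 * r + 1 + 1)) :=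
  ⟨(1 - (s : ℝ)) • (stdSimplex.map (leftHalf r) t).1 +
      (s : ℝ) • (stdSimplex.map (rightHalf r) t).1,
    convex_stdSimplex ℝ _ (stdSimplex.map (leftHalf r) t).2 (stdSimplex.map (rightHalf r) t).2
      (sub_nonneg.2 s.2.2) s.2.1 (sub_add_cancel _ _)⟩

theorem continuous_spread {r : ℕ} :
    Continuous fun q : unitInterval × stdSimplex ℝ (Fin (r + 1)) => spread q.1 q.2 := by
  have h : Continuous fun q : unitInterval × stdSimplex ℝ (Fin (r + 1)) => (q.1 : ℝ) :=
    continuous_subtype_val.comp continuous_fst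
  refine Continuous.subtype_mk ?_ _
  exact ((continuous_const.sub h).smul (continuous_subtype_val.comp
    ((stdSimplex.continuous_map _).comp continuous_snd))).add (h.smul
    (continuous_subtype_val.comp ((stdSimplex.continuous_map _).comp continuous_snd)))

theorem mass_spread {r : ℕ} (s : unitInterval) (t : stdSimplex ℝ (Fin (r + 1)))
    (A : Set (Fin (2 * r + 1 + 1))) :
    mass (spread s t) A =
      (1 - (s : ℝ)) * mass t (leftHalf r ⁻¹' A) + s * mass t (rightHalf r ⁻¹' A) := by
  rw [← mass_map, ← mass_map]
  unfold mass
  rw [Finset.mul_sum, Finset.mul_sum, ← Finset.sum_add_distrib]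
  refine Finset.sum_congr rfl fun i _ => ?_
  by_cases h : i ∈ A
  · simp only [indicator_of_mem h]
    rfl
  · simp [indicator_of_notMem h]

theorem spread_one {r : ℕ} (t : stdSimplex ℝ (Fin (r + 1))) :
    spread 1 t = stdSimplex.map (rightHalf r) t :=
  stdSimplex_ext_mass fun k => by simp [mass_spread, mass_map]

theorem map_double_spread {m r : ℕ} (α : Fin (m + 1) →o Fin (r + 1)) (s : unitInterval)
    (t : stdSimplex ℝ (Fin (m + 1))) :
    stdSimplex.map (double α) (spread s t) = spread s (stdSimplex.map α t) := by
  refine stdSimplex_ext_mass fun k => ?_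
  rw [mass_map, mass_spread, mass_spread, mass_map, mass_map]
  congr 3 <;> ext i <;> simp

/-- The midpoint of the unit interval. -/
noncomputable def oneHalf : unitInterval := ⟨1 / 2, by norm_num, by norm_num⟩

theorem mass_spread_oneHalf {r : ℕ} (t : stdSimplex ℝ (Fin (r + 1)))
    (A : Set (Fin (2 * r + 1 + 1))) :
    mass (spread oneHalf t) A =
      (mass t (leftHalf r ⁻¹' A) + mass t (rightHalf r ⁻¹' A)) / 2 := by
  have : (oneHalf : ℝ) = 1 / 2 := rfl
  rw [mass_spread, this]
  ring

theorem spread_oneHalf_pos {r : ℕ} {t : stdSimplex ℝ (Fin (r + 1))} (ht : ∀ i, 0 < t i)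
    (j : Fin (2 * r + 1 + 1)) : 0 < spread oneHalf t j := by
  have h₁ : mass (spread oneHalf t) {j} = spread oneHalf t j := by
    simpa using mass_insert (spread oneHalf t) (A := ∅) (a := j) (by simp)
  have h₂ : ∀ i A, i ∈ A → 0 < mass t A := by
    intro i A hi
    refine (ht i).trans_le ?_
    have h := mass_insert t (A := ∅) (a := i) (by simp)
    rw [mass_empty, add_zero] at h
    rw [← h]
    exact mass_mono t (by simpa using hi)
  rw [← h₁, mass_spread_oneHalf]
  have hl := mass_nonneg t (leftHalf r ⁻¹' {j})
  have hr := mass_nonneg t (rightHalf r ⁻¹' {j})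
  obtain ⟨i, hi⟩ | ⟨i, hi⟩ := eq_leftHalf_or_rightHalf j
  · linarith [h₂ i (leftHalf r ⁻¹' {j}) hi]
  · linarith [h₂ i (rightHalf r ⁻¹' {j}) hi]

/-- The edgewise subdivision covers the simplex: every point of `Δⁿ` lies in the image, under an
affine map given by some monotone map of vertices, of the middle copy of `Δⁿ` in `Δ²ⁿ⁺¹`. -/
theorem exists_map_spread_eq {n : ℕ} (x : stdSimplex ℝ (Fin (n + 1))) :
    ∃ (α : Fin (2 * n + 1 + 1) →o Fin (n + 1)) (t : stdSimplex ℝ (Fin (n + 1))),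
      stdSimplex.map α (spread oneHalf t) = x := by
  -- The distribution function of `t` takes the values `|2c - 1|`, in increasing order, where `c`
  -- runs through the values of the distribution function of `x`: the unit interval is folded at
  -- its midpoint.
  let c : Fin (n + 1) → ℝ := fun k => |2 * mass x (Iic k) - 1|
  have hlast : c (Fin.last n) = 1 := by norm_num [c]
  have hle : ∀ k, c k ≤ 1 := by
    intro k
    have h₁ := mass_nonneg x (Iic k)
    have h₂ := mass_le_one x (Iic k)
    exact abs_le.2 ⟨by linarith, by linarith⟩
  let e := Tuple.sort c
  obtain ⟨t, ht⟩ := exists_stdSimplex_mass_eq (c ∘ e) (Tuple.monotone_sort c) (abs_nonneg _) (by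
    refine le_antisymm (hle _) ?_
    have := Tuple.monotone_sort c (Fin.le_last (e.symm (Fin.last n)))
    simpa [e, hlast] using this)
  obtain ⟨α, hα⟩ := exists_map_eq (spread oneHalf t) x fun k => by
    have hk : mass t (Iic (e.symm k)) = c k := by simp [ht]
    rcases abs_choice (2 * mass x (Iic k) - 1) with h | h
    · refine ⟨Iic (rightHalf n (e.symm k)), isLowerSet_Iic _, ?_⟩
      have hl : leftHalf n ⁻¹' Iic (rightHalf n (e.symm k)) = univ :=
        eq_univ_of_forall fun i => (leftHalf_lt_rightHalf i _).le
      have hr : rightHalf n ⁻¹' Iic (rightHalf n (e.symm k)) = Iic (e.symm k) := by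
        ext i
        exact rightHalf_le_rightHalf
      rw [mass_spread_oneHalf, hl, hr, hk, mass_univ]
      simp only [c, h]
      ring
    · refine ⟨Iio (leftHalf n (e.symm k)), isLowerSet_Iio _, ?_⟩
      have hl : leftHalf n ⁻¹' Iio (leftHalf n (e.symm k)) = (Iic (e.symm k))ᶜ := by
        ext i
        simp [leftHalf_lt_leftHalf]
      have hr : rightHalf n ⁻¹' Iio (leftHalf n (e.symm k)) = ∅ :=
        eq_empty_of_forall_notMem fun i hi => (leftHalf_lt_rightHalf _ i).not_gt hi
      rw [mass_spread_oneHalf, hl, hr, mass_compl, hk, mass_empty]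
      simp only [c, h]
      ring
  exact ⟨α, t, hα⟩

end Edgewise

/-- If finitely many continuous maps from a compact space cover a Hausdorff space `L`, then
continuity of a function on `Z × L` can be checked on the pieces. The reason is that the resulting
map from the disjoint union of the pieces to `L` is proper and onto, so that it remains a quotient
map after taking the product with `Z`. -/
theorem continuous_of_finite_cover {A Z W K L : Type*} [Finite A] [TopologicalSpace Z]
    [TopologicalSpace W] [TopologicalSpace K] [CompactSpace K] [TopologicalSpace L] [T2Space L]
    {c : A → K → L} (hc : ∀ a, Continuous (c a)) (hsurj : ∀ x, ∃ a t, c a t = x) {F : Z × L → W}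
    (hF : ∀ a, Continuous fun q : Z × K => F (q.1, c a q.2)) : Continuous F := by
  let : TopologicalSpace A := ⊥
  have : DiscreteTopology A := ⟨rfl⟩
  have hc' : Continuous fun z : A × K => c z.1 z.2 := continuous_prod_of_discrete_left.2 hc
  have hq : Topology.IsQuotientMap (Prod.map (id : Z → Z) fun z : A × K => c z.1 z.2) :=
    (isProperMap_id.prodMap hc'.isProperMap).isClosedMap.isQuotientMap
      (continuous_id.prodMap hc') (Function.surjective_id.prodMap fun x => by
        obtain ⟨a, t, h⟩ := hsurj x
        exact ⟨(a, t), h⟩)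
  have h : Continuous fun p : A × (Z × K) => F (p.2.1, c p.1 p.2.2) :=
    continuous_prod_of_discrete_left.2 hF
  exact hq.continuous_iff.2 (h.comp ((continuous_fst.comp continuous_snd).prodMk
    (continuous_fst.prodMk (continuous_snd.comp continuous_snd))))

/-- Continuity can be checked on the pieces of the edgewise subdivision of a simplex, also in the
presence of parameters. -/
theorem continuous_of_continuous_pieces {Z W : Type*} [TopologicalSpace Z] [TopologicalSpace W]
    {n : ℕ} {F : Z × stdSimplex ℝ (Fin (n + 1)) → W}
    (hF : ∀ α : Fin (2 * n + 1 + 1) →o Fin (n + 1),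
      Continuous fun q : Z × stdSimplex ℝ (Fin (n + 1)) =>
        F (q.1, stdSimplex.map α (spread oneHalf q.2))) : Continuous F := by
  have : Finite (Fin (2 * n + 1 + 1) →o Fin (n + 1)) :=
    Finite.of_injective (fun α => (α : Fin (2 * n + 1 + 1) → Fin (n + 1))) DFunLike.coe_injective
  have hspread : Continuous fun t : stdSimplex ℝ (Fin (n + 1)) => spread oneHalf t :=
    continuous_spread.comp (continuous_const.prodMk continuous_id)
  exact continuous_of_finite_cover
    (c := fun (α : Fin (2 * n + 1 + 1) →o Fin (n + 1)) t => stdSimplex.map α (spread oneHalf t))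
    (fun α => (stdSimplex.continuous_map α).comp hspread) exists_map_spread_eq hF

/-! ### Totalization and edgewise subdivision -/

section TotEdgewise

/-- The edgewise subdivision of a cosimplicial space. -/
def edgewiseSub (X : CosimplicialObject TopCat.{u}) : CosimplicialObject TopCat.{u} :=
  edgewise ⋙ X

/-- The map from a cosimplicial space to its edgewise subdivision induced by the inclusions of
`[r]` as the second half of `[r]ᵒᵖ * [r]`. -/
def toEdgewiseSub (X : CosimplicialObject TopCat.{u}) : X ⟶ edgewiseSub X :=
  Functor.whiskerRight toEdgewise X

variable {X : CosimplicialObject TopCat.{u}}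

theorem continuous_tot_eval (n : SimplexCategory) : Continuous
    fun q : Tot X × stdSimplex ℝ (Fin (n.len + 1)) => q.1.1 n q.2 :=
  continuous_eval.comp ((((continuous_apply n).comp continuous_subtype_val).comp
    continuous_fst).prodMk continuous_snd)

theorem continuous_tot_of_uncurry {Z : Type*} [TopologicalSpace Z] (F : Z → Tot X)
    (hF : ∀ n, Continuous fun q : Z × stdSimplex ℝ (Fin (n.len + 1)) => (F q.1).1 n q.2) :
    Continuous F :=
  continuous_induced_rng.2 (continuous_pi fun n =>
    ContinuousMap.continuous_of_continuous_uncurry _ (hF n))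

variable (X) in
/-- The map from the totalization of `X` to that of its edgewise subdivision that restricts a
point of the totalization to the copies `spread s` of the simplices `Δʳ` in `Δ²ʳ⁺¹`. -/
noncomputable def spreadTot (s : unitInterval) (f : Tot X) : Tot (edgewiseSub X) :=
  ⟨fun n => ⟨fun t => f.1 (edgewise.obj n) (spread s t), (f.1 (edgewise.obj n)).continuous.comp
      (continuous_spread.comp (continuous_const.prodMk continuous_id))⟩,
    fun _ n α t => (f.2 _ _ (edgewise.map α) (spread s t)).trans
      (congrArg (f.1 (edgewise.obj n)) (map_double_spread α.toOrderHom s t))⟩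

theorem spreadTot_apply (s : unitInterval) (f : Tot X) (n : SimplexCategory)
    (t : stdSimplex ℝ (Fin (n.len + 1))) :
    (spreadTot X s f).1 n t = f.1 (edgewise.obj n) (spread s t) := rfl

theorem continuous_spreadTot :
    Continuous fun q : unitInterval × Tot X => spreadTot X q.1 q.2 := by
  refine continuous_tot_of_uncurry _ fun n => ?_
  exact (continuous_tot_eval (edgewise.obj n)).comp ((continuous_snd.comp continuous_fst).prodMk
    (continuous_spread.comp ((continuous_fst.comp continuous_fst).prodMk continuous_snd)))

/-- The values that a point of the totalization of the edgewise subdivision prescribes on the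
pieces of `Δⁿ` agree wherever two pieces meet. -/
theorem map_eq_map_of_map_spread_eq (g : Tot (edgewiseSub X)) {a b n : SimplexCategory}
    (α : edgewise.obj a ⟶ n) (β : edgewise.obj b ⟶ n) (t : stdSimplex ℝ (Fin (a.len + 1)))
    (t' : stdSimplex ℝ (Fin (b.len + 1)))
    (h : stdSimplex.map α.toOrderHom (spread oneHalf t) =
      stdSimplex.map β.toOrderHom (spread oneHalf t')) :
    X.map α (g.1 a t) = X.map β (g.1 b t') := by
  -- On a common refinement of `t` and `t'`, the two maps of vertices become equal.
  obtain ⟨m, w, γ, γ', hw, rfl, rfl⟩ := exists_common_refinement t t'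
  let c : SimplexCategory.mk m ⟶ a := SimplexCategory.Hom.mk γ
  let c' : SimplexCategory.mk m ⟶ b := SimplexCategory.Hom.mk γ'
  have hc : edgewise.map c ≫ α = edgewise.map c' ≫ β := by
    refine SimplexCategory.Hom.ext _ _ (eq_of_map_eq (spread_oneHalf_pos hw) ?_)
    rw [← map_double_spread, ← map_double_spread] at h
    exact (stdSimplex.map_comp_apply (double γ) α.toOrderHom _).symm.trans
      (h.trans (stdSimplex.map_comp_apply (double γ') β.toOrderHom _))
  have h₁ : X.map α (g.1 a (stdSimplex.map γ w)) =
      X.map (edgewise.map c ≫ α) (g.1 (SimplexCategory.mk m) w) := by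
    rw [X.map_comp]
    exact congrArg (X.map α) (g.2 _ _ c w).symm
  have h₂ : X.map β (g.1 b (stdSimplex.map γ' w)) =
      X.map (edgewise.map c' ≫ β) (g.1 (SimplexCategory.mk m) w) := by
    rw [X.map_comp]
    exact congrArg (X.map β) (g.2 _ _ c' w).symm
  rw [h₁, h₂, hc]

/-- The value at `x ∈ Δⁿ` of the map glued from the maps that `g` prescribes on the pieces of the
edgewise subdivision of `Δⁿ`. -/
noncomputable def glueFun (g : Tot (edgewiseSub X)) (n : SimplexCategory)
    (x : stdSimplex ℝ (Fin (n.len + 1))) : X.obj n :=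
  X.map (SimplexCategory.Hom.mk (exists_map_spread_eq x).choose : edgewise.obj n ⟶ n)
    (g.1 n (exists_map_spread_eq x).choose_spec.choose)

theorem glueFun_map_spread (g : Tot (edgewiseSub X)) {a n : SimplexCategory}
    (α : edgewise.obj a ⟶ n) (t : stdSimplex ℝ (Fin (a.len + 1))) :
    glueFun g n (stdSimplex.map α.toOrderHom (spread oneHalf t)) = X.map α (g.1 a t) :=
  map_eq_map_of_map_spread_eq g _ _ _ _ (exists_map_spread_eq _).choose_spec.choose_spec

theorem continuous_glueFun (n : SimplexCategory) : Continuous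
    fun q : Tot (edgewiseSub X) × stdSimplex ℝ (Fin (n.len + 1)) => glueFun q.1 n q.2 := by
  refine continuous_of_continuous_pieces fun α => ?_
  let α' : edgewise.obj n ⟶ n := SimplexCategory.Hom.mk α
  exact ((X.map α').hom.continuous.comp (continuous_tot_eval (X := edgewiseSub X) n)).congr
    fun q => (glueFun_map_spread q.1 α' q.2).symm

/-- A point of the totalization of the edgewise subdivision, glued to a point of the
totalization. -/
noncomputable def glueTot (g : Tot (edgewiseSub X)) : Tot X :=
  ⟨fun n => ⟨glueFun g n, (continuous_glueFun n).comp (continuous_const.prodMk continuous_id)⟩,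
    fun m n β x => by
      obtain ⟨α, t, rfl⟩ := exists_map_spread_eq x
      let α' : edgewise.obj m ⟶ m := SimplexCategory.Hom.mk α
      have h₁ : glueFun g m (stdSimplex.map α (spread oneHalf t)) = X.map α' (g.1 m t) :=
        glueFun_map_spread g α' t
      have h₂ : glueFun g n (stdSimplex.map β.toOrderHom (stdSimplex.map α (spread oneHalf t))) =
          X.map (α' ≫ β) (g.1 m t) := by
        exact (congrArg (glueFun g n) (stdSimplex.map_comp_apply α β.toOrderHom _)).trans
          (glueFun_map_spread g (α' ≫ β) t)
      change X.map β (glueFun g m _) = glueFun g n _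
      rw [h₁, h₂, X.map_comp]
      rfl⟩

variable (X) in
/-- The totalization of the edgewise subdivision of a cosimplicial space is homeomorphic to the
totalization of the cosimplicial space. -/
noncomputable def totEdgewise : Tot X ≃ₜ Tot (edgewiseSub X) where
  toFun := spreadTot X oneHalf
  invFun := glueTot
  left_inv f := by
    refine Subtype.ext (funext fun n => ContinuousMap.ext fun x => ?_)
    obtain ⟨α, t, rfl⟩ := exists_map_spread_eq x
    exact (glueFun_map_spread (spreadTot X oneHalf f)
      (SimplexCategory.Hom.mk α : edgewise.obj n ⟶ n) t).trans (f.2 _ _ _ _)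
  right_inv g := by
    refine Subtype.ext (funext fun n => ContinuousMap.ext fun t => ?_)
    rw [spreadTot_apply]
    have h := glueFun_map_spread g (𝟙 (edgewise.obj n)) t
    rw [X.map_id] at h
    have h' : stdSimplex.map (SimplexCategory.Hom.toOrderHom (𝟙 (edgewise.obj n)))
        (spread oneHalf t) = spread oneHalf t := stdSimplex.map_id_apply _
    rw [h'] at h
    exact h
  continuous_toFun := continuous_spreadTot.comp (continuous_const.prodMk continuous_id)
  continuous_invFun := continuous_tot_of_uncurry _ continuous_glueFun

/-- The map induced by the inclusions of `[r]` as the second half of `[r]ᵒᵖ * [r]` is the end of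
a homotopy that starts with the homeomorphism `totEdgewise X`: the middle copy of `Δʳ` in `Δ²ʳ⁺¹`
is moved to the second half along straight lines. -/
theorem totMap_toEdgewise_homotopic :
    (Tot.map (toEdgewiseSub X)).Homotopic
      (totEdgewise X) := by
  refine ContinuousMap.Homotopic.symm ⟨
    { toFun := fun q => spreadTot X (max oneHalf q.1) q.2
      continuous_toFun := continuous_spreadTot.comp
        ((continuous_const.max continuous_fst).prodMk continuous_snd)
      map_zero_left := fun f => ?_
      map_one_left := fun f => ?_ }⟩
  · have h : max oneHalf (0 : unitInterval) = oneHalf := max_eq_left unitInterval.nonneg'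
    rw [h]
    rfl
  · have h : max oneHalf (1 : unitInterval) = 1 := max_eq_right unitInterval.le_one'
    rw [h]
    refine Subtype.ext (funext fun n => ContinuousMap.ext fun t => ?_)
    rw [spreadTot_apply, spread_one]
    exact (f.2 _ _ (toEdgewise.app n) t).symm

theorem Tot.map_comp {X Y Z : CosimplicialObject TopCat.{u}} (η : X ⟶ Y) (θ : Y ⟶ Z) :
    Tot.map (η ≫ θ) = (Tot.map θ).comp (Tot.map η) := rfl

/-- The homeomorphism of totalizations induced by an isomorphism of cosimplicial spaces. -/
def Tot.mapIso {X Y : CosimplicialObject TopCat.{u}} (e : X ≅ Y) : Tot X ≃ₜ Tot Y where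
  toFun := Tot.map e.hom
  invFun := Tot.map e.inv
  left_inv f := by
    change (Tot.map e.inv).comp (Tot.map e.hom) f = f
    rw [← Tot.map_comp, e.hom_inv_id]
    rfl
  right_inv f := by
    change (Tot.map e.hom).comp (Tot.map e.inv) f = f
    rw [← Tot.map_comp, e.inv_hom_id]
    rfl
  continuous_toFun := (Tot.map e.hom).continuous
  continuous_invFun := (Tot.map e.inv).continuous

theorem isWeakEquivalence_totMap_toEdgewise_comp {Y : CosimplicialObject TopCat.{u}}
    (e : edgewiseSub X ≅ Y) :
    IsWeakEquivalence (Tot.map (toEdgewiseSub X ≫ e.hom)) := by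
  refine IsWeakEquivalence.of_homotopic ?_
    (isWeakEquivalence_homeomorph ((totEdgewise X).trans (Tot.mapIso e)))
  exact (ContinuousMap.Homotopic.refl (Tot.map e.hom)).comp totMap_toEdgewise_homotopic

end TotEdgewise

/-! ### The twisted arrow poset -/

section TwistedArrow

variable {P : Type u} [Preorder P]

theorem nerve_ext_halves {r : ℕ} {v w : Nerve P (2 * r + 1)}
    (hl : ∀ i, v.1 (leftHalf r i) = w.1 (leftHalf r i))
    (hr : ∀ i, v.1 (rightHalf r i) = w.1 (rightHalf r i)) : v = w := by
  refine Subtype.ext (funext fun j => ?_)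
  obtain ⟨i, rfl⟩ | ⟨i, rfl⟩ := eq_leftHalf_or_rightHalf j
  · exact hl i
  · exact hr i

/-- A string `(a₀ ≤ b₀) ≥ ⋯ ≥ (aᵣ ≤ bᵣ)` of twisted arrows, viewed as the string
`bᵣ ≥ ⋯ ≥ b₀ ≥ a₀ ≥ ⋯ ≥ aᵣ`. -/
def unfoldString {r : ℕ} (w : Nerve (TwistedArrow P) r) : Nerve P (2 * r + 1) :=
  ⟨fun j => if h : (j : ℕ) ≤ r then (w.1 ⟨r - j, by omega⟩).1.2 else
      (w.1 ⟨j - (r + 1), by omega⟩).1.1, fun i j hij => by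
    have hij' : (i : ℕ) ≤ j := hij
    dsimp only
    split_ifs with hj hi hi
    · exact (w.2 (by simp only [Fin.le_def]; omega)).2
    · omega
    · refine (w.1 _).2.trans' (w.2 (Fin.zero_le _)).1 |>.trans (w.2 (Fin.zero_le _)).2
    · exact (w.2 (by simp only [Fin.le_def]; omega)).1⟩

theorem unfoldString_leftHalf {r : ℕ} (w : Nerve (TwistedArrow P) r) (i : Fin (r + 1)) :
    (unfoldString w).1 (leftHalf r i) = (w.1 i).1.2 := by
  refine (dif_pos (show r - (i : ℕ) ≤ r by omega)).trans ?_
  congr 2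
  exact congrArg w.1 (Fin.ext (show r - (r - (i : ℕ)) = i by omega))

theorem unfoldString_rightHalf {r : ℕ} (w : Nerve (TwistedArrow P) r) (i : Fin (r + 1)) :
    (unfoldString w).1 (rightHalf r i) = (w.1 i).1.1 := by
  refine (dif_neg (show ¬ r + 1 + (i : ℕ) ≤ r by omega)).trans ?_
  congr 2
  exact congrArg w.1 (Fin.ext (show r + 1 + (i : ℕ) - (r + 1) = i by omega))

theorem unfoldString_last {r : ℕ} (w : Nerve (TwistedArrow P) r) :
    (unfoldString w).1 (Fin.last (2 * r + 1)) = (w.1 (Fin.last r)).1.1 := by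
  have h : Fin.last (2 * r + 1) = rightHalf r (Fin.last r) :=
    Fin.ext (by rw [val_rightHalf, Fin.val_last, Fin.val_last]; omega)
  rw [h, unfoldString_rightHalf]

variable [TopologicalSpace P] {M : Type u} [TopologicalSpace M]

variable (P) in
/-- The nerve of the twisted arrow poset of `P` is the edgewise subdivision of the nerve
of `P`. -/
def unfoldHomeo (r : ℕ) : Nerve (TwistedArrow P) r ≃ₜ Nerve P (2 * r + 1) where
  toFun := unfoldString
  invFun v := ⟨fun i => ⟨(v.1 (rightHalf r i), v.1 (leftHalf r i)),
      v.2 (leftHalf_lt_rightHalf i i).le⟩, fun _ _ h =>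
    ⟨v.2 (rightHalf_le_rightHalf.2 h), v.2 (leftHalf_le_leftHalf.2 h)⟩⟩
  left_inv w := Subtype.ext (funext fun i => Subtype.ext
    (Prod.ext (unfoldString_rightHalf w i) (unfoldString_leftHalf w i)))
  right_inv v := nerve_ext_halves (unfoldString_leftHalf _) (unfoldString_rightHalf _)
  continuous_toFun := by
    have h : ∀ i, Continuous fun w : Nerve (TwistedArrow P) r => (w.1 i).1 := fun i =>
      continuous_subtype_val.comp ((continuous_apply i).comp continuous_subtype_val)
    refine continuous_induced_rng.2 (continuous_pi fun j => ?_)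
    obtain ⟨i, rfl⟩ | ⟨i, rfl⟩ := eq_leftHalf_or_rightHalf j
    · exact (continuous_snd.comp (h i)).congr fun w => (unfoldString_leftHalf w i).symm
    · exact (continuous_fst.comp (h i)).congr fun w => (unfoldString_rightHalf w i).symm
  continuous_invFun := by
    have h : ∀ j, Continuous fun v : Nerve P (2 * r + 1) => v.1 j := fun j =>
      (continuous_apply j).comp continuous_subtype_val
    exact continuous_induced_rng.2 (continuous_pi fun i =>
      continuous_induced_rng.2 ((h _).prodMk (h _)))

theorem unfoldString_pull {m r : ℕ} (α : Fin (m + 1) →o Fin (r + 1))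
    (w : Nerve (TwistedArrow P) r) :
    unfoldString (Nerve.pull α w) = Nerve.pull (double α) (unfoldString w) := by
  refine nerve_ext_halves (fun i => ?_) fun i => ?_
  · refine (unfoldString_leftHalf _ i).trans ?_
    change _ = (unfoldString w).1 (double α (leftHalf m i))
    rw [double_leftHalf, unfoldString_leftHalf]
    rfl
  · refine (unfoldString_rightHalf _ i).trans ?_
    change _ = (unfoldString w).1 (double α (rightHalf m i))
    rw [double_rightHalf, unfoldString_rightHalf]
    rfl

/-- Sections over strings of twisted arrows are sections over strings of twice the length. -/
def sectionUnfold (Ψ : Pᵒᵈ →o Set M) (r : ℕ) :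
    SectionSpace Ψ (2 * r + 1) ≃ₜ SectionSpace (Ψ.comp (OrderHom.dual (source P))) r where
  toFun τ := ⟨τ.1.comp
      (unfoldHomeo P r : C(Nerve (TwistedArrow P) r, Nerve P (2 * r + 1))), fun w => by
    have h := τ.2 (unfoldString w)
    rw [unfoldString_last] at h
    exact h⟩
  invFun τ := ⟨τ.1.comp
      ((unfoldHomeo P r).symm : C(Nerve P (2 * r + 1), Nerve (TwistedArrow P) r)), fun v => by
    have h := τ.2 ((unfoldHomeo P r).symm v)
    have h' := unfoldString_last ((unfoldHomeo P r).symm v)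
    rw [show unfoldString ((unfoldHomeo P r).symm v) = v from
      (unfoldHomeo P r).apply_symm_apply v] at h'
    rw [h']
    exact h⟩
  left_inv τ := Subtype.ext (ContinuousMap.ext fun v =>
    congrArg τ.1 ((unfoldHomeo P r).apply_symm_apply v))
  right_inv τ := Subtype.ext (ContinuousMap.ext fun w =>
    congrArg τ.1 ((unfoldHomeo P r).symm_apply_apply w))
  continuous_toFun := continuous_induced_rng.2
    ((ContinuousMap.continuous_precomp
      (unfoldHomeo P r : C(Nerve (TwistedArrow P) r, Nerve P (2 * r + 1)))).comp
        continuous_subtype_val)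
  continuous_invFun := continuous_induced_rng.2
    ((ContinuousMap.continuous_precomp
      ((unfoldHomeo P r).symm : C(Nerve P (2 * r + 1), Nerve (TwistedArrow P) r))).comp
        continuous_subtype_val)

/-- The cosimplicial space of sections over the twisted arrow poset is the edgewise subdivision of
the cosimplicial space of sections over `P`. -/
def edgewiseSections (Ψ : Pᵒᵈ →o Set M) :
    edgewiseSub (sections Ψ) ≅ sections (Ψ.comp (OrderHom.dual (source P))) :=
  NatIso.ofComponents (fun n =>
    { hom := TopCat.ofHom ⟨sectionUnfold Ψ n.len, (sectionUnfold Ψ n.len).continuous⟩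
      inv := TopCat.ofHom ⟨(sectionUnfold Ψ n.len).symm, (sectionUnfold Ψ n.len).symm.continuous⟩
      hom_inv_id := by
        ext τ
        exact (sectionUnfold Ψ n.len).symm_apply_apply τ
      inv_hom_id := by
        ext τ
        exact (sectionUnfold Ψ n.len).apply_symm_apply τ }) fun {m n} α => by
    ext τ
    refine Subtype.ext (ContinuousMap.ext fun w => ?_)
    exact congrArg τ.1 (unfoldString_pull α.toOrderHom w).symm

/-- For every topological poset `P` and every contravariant functor `Ψ` to the subspaces of a
space, prolongation along the source functor of the twisted arrow poset is a weak equivalence. -/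
theorem isWeakEquivalence_holimPull_source (Ψ : Pᵒᵈ →o Set M) :
    IsWeakEquivalence (holimPull Ψ (source P) continuous_source) := by
  have h : sectionsPull Ψ (source P) continuous_source =
      toEdgewiseSub (sections Ψ) ≫ (edgewiseSections Ψ).hom := by
    ext n τ
    refine Subtype.ext (ContinuousMap.ext fun w => ?_)
    exact congrArg τ.1 (Subtype.ext (funext fun i => (unfoldString_rightHalf w i).symm) :
      Nerve.push (source P) continuous_source n.len w =
        Nerve.pull (rightHalf n.len) (unfoldString w))
  unfold holimPull
  rw [h]
  exact isWeakEquivalence_totMap_toEdgewise_comp (edgewiseSections Ψ)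

end TwistedArrow

end Occupants

theorem mainTheorem6 (n : ℕ) (M : Type u) [TopologicalSpace M] [T2Space M] [CompactSpace M]
    [ChartedSpace (EuclideanQuadrant n) M] [IsManifold (Occupants.corners n) ∞ M]
    (B : Occupants.BoundarySplitting n M) (g : Occupants.Metric n M)
    (hg : Occupants.IsProductNear g B.bd₁) :
    Occupants.IsWeakEquivalence
      (Occupants.holimPull (Occupants.Psi B g) (Occupants.source (Occupants.OccupantPoset B g))
        Occupants.continuous_source) := by
  exact Occupants.isWeakEquivalence_holimPull_source (Occupants.Psi B g)
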